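/- Two players toss coins with heads probabilities $q<p$ respectively, $n$ times each, and $N(q,p)$ denotes the (smallest) value of $n$ that maximizes the probability that the player with the weaker coin $q$ gets strictly more heads. Consider the upper bound $$U(q,p)=\left\lceil\frac{\max(1-p,q)}{p-q}\right\rceil$$ for $N(q,p)$ and the combined lower bound $$L(q,p)=\max\left(\left\lceil\frac{1-p}{p-q/2}\right\rceil,\ \left\lfloor\frac{1}{2(p-q)}+\frac12\right\rfloor\right)$$ on the open triangle $T=\{(q,p): 0<q<p<1-q\}$ (the interior of the triangle whose vertices, in $(p,q)$-coordinates, are $(0,0)$, $(1,0)$, $(\tfrac12,\tfrac12)$). Theorem. For $(q,p)$ chosen uniformly from $T$, the probability that $U(q,p)=L(q,p)$ is $$(1-i)\,\psi(3-i)+(1+i)\,\psi(3+i)+\frac{\pi^2}{4}+2\gamma-\frac{115}{27},$$ where $\psi=\Gamma'/\Gamma$ is the digamma function and $\gamma$ is Euler's constant. This number is $0.60$ to two decimals (its distance from $0.60$ is less than $0.005$). Moreover, it is a sum of areas of triangles, relative to the area of $T$: for every integer $n\ge 0$ the set of points of $T$ at which $U=L=n$ is, up to a set of measure zero, the union of a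 finite family $F_n$ of nondegenerate closed triangles (possibly empty), and the families can be chosen so that the probability equals $\sum_{n}\sum_{t\in F_n}\operatorname{area}(t)/\operatorname{area}(T)$. -/

import Mathlib

namespace WeakCoin

/-- The open triangle `T` in the plane of points `x = (q, p)`: the interior of the triangle in which
`(p, q)` has the vertices `(0, 0)`, `(1, 0)` and `(1/2, 1/2)`. -/
def T : Set (ℝ × ℝ) :=
  {x | 0 < x.1 ∧ x.1 < x.2 ∧ x.1 + x.2 < 1}

/-- The uniform probability distribution on the triangle `T`. -/
noncomputable def uniformT : MeasureTheory.Measure (ℝ × ℝ) :=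
  ProbabilityTheory.cond MeasureTheory.volume T

/-- The upper bound on `N(q, p)`, where `N(q, p)` is the least `n` that maximizes the probability that,
in `n` tosses each, a coin of heads probability `q` shows more heads than one of heads probability
`p > q`. -/
noncomputable def upperBound (q p : ℝ) : ℤ :=
  ⌈max (1 - p) q / (p - q)⌉

/-- The general lower bound on `N(q, p)`, valid for `p + q ≠ 1`. -/
noncomputable def generalLowerBound (q p : ℝ) : ℤ :=
  ⌊1 / (2 * (p - q)) + 1 / 2⌋

/-- The lower bound on `N(q, p)` that comes from the lines
`p = 1 / (n + 1) + n * q / (2 * (n + 1))`. -/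
noncomputable def linearLowerBound (q p : ℝ) : ℤ :=
  ⌈(1 - p) / (p - q / 2)⌉

/-- The combined lower bound: the better one of the two lower bounds. -/
noncomputable def combinedLowerBound (q p : ℝ) : ℤ :=
  max (linearLowerBound q p) (generalLowerBound q p)

/-- The points `(q, p)` at which the upper bound and the combined lower bound agree. -/
def agreement : Set (ℝ × ℝ) :=
  {x | upperBound x.1 x.2 = combinedLowerBound x.1 x.2}

/-- The points `(q, p)` of `T` at which both bounds are equal to `n`. -/
def agreementLevel (n : ℕ) : Set (ℝ × ℝ) :=
  {x | x ∈ T ∧ upperBound x.1 x.2 = n ∧ combinedLowerBound x.1 x.2 = n}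

end WeakCoin

/-! On `T` one has `q < 1 - p`, so `U ≤ n` means `(n+1)p - nq ≥ 1`. Likewise `n ≤ L` means `np -
(n-1)q/2 < 1` (linear bound) or `(2n-1)(p-q) ≤ 1` (general bound). Since `L ≤ U` on `T`, the set `U
= L = n` is cut out by these inequalities.

For `n ≥ 3` it consists, up to null sets, of two almost disjoint triangles: one with an edge on `q =
0`, of area `1/(n(n+1)(n²+1))`, and one with an edge on `p + q = 1`, of area `1/((2n+1)(2n-1)²)`.
For `n = 2` the two overlap and the second is truncated, for `n = 1` a single triangle remains, and
`n = 0` is impossible (`hasTriangulation_agreementLevel`).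

As `T` has area `1/4`, the probability is the sum of four times the areas. Partial fractions over
`ℂ` split a term into differences `1/n - 1/(n ∓ i)`, summed by digamma values
(`hasSum_digamma_sub`), telescoping differences, and inverse odd squares, which give `π²`. Euler's
constant enters through `ψ(3) = 3/2 - γ`. The numerical value comes from 16 terms and a telescoping
bound for the tail. -/

section

open Filter Topology Finset MeasureTheory

namespace WeakCoin

/-! ### Series for the digamma function on the right half plane -/

/-- The general term of the series `∑ j, logGammaTerm j z = log Γ(z) + log z`. -/
noncomputable def logGammaTerm (j : ℕ) (z : ℂ) : ℂ :=
  z * ((Real.log (j + 2) - Real.log (j + 1) : ℝ) : ℂ) -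
    (Complex.log (z + (j + 1)) - ((Real.log (j + 1) : ℝ) : ℂ))

theorem mem_slitPlane_of_re_pos {z : ℂ} (hz : 0 < z.re) : z ∈ Complex.slitPlane :=
  Or.inl hz

theorem hasDerivAt_logGammaTerm (j : ℕ) {z : ℂ} (hz : 0 < z.re) :
    HasDerivAt (logGammaTerm j)
      (((Real.log (j + 2) - Real.log (j + 1) : ℝ) : ℂ) - 1 / (z + (j + 1))) z := by
  have h1 : 0 < (z + (j + 1)).re := by simp; positivity
  have h2 := ((hasDerivAt_id z).add_const ((j : ℂ) + 1)).clog (mem_slitPlane_of_re_pos h1)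
  have h3 := (hasDerivAt_id z).mul_const ((Real.log (j + 2) - Real.log (j + 1) : ℝ) : ℂ)
  have h4 := h3.sub (h2.sub_const ((Real.log (j + 1) : ℝ) : ℂ))
  exact (show HasDerivAt (logGammaTerm j) _ z from h4).congr_deriv (by simp)

/-- Both `log ((j+2)/(j+1))` and `1/(z+j+1)` are close to `1/(j+1)`: the first within `1/(j+1)²`,
the second within `‖z‖/(j+1)²`, because `Re z > 0` gives `‖z+j+1‖ ≥ j+1`. The bound is summable and
uniform on bounded sets, which allows termwise differentiation. -/
theorem norm_deriv_logGammaTerm_le (j : ℕ) {z : ℂ} (hz : 0 < z.re) {R : ℝ} (hR : ‖z‖ ≤ R) :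
    ‖((Real.log (j + 2) - Real.log (j + 1) : ℝ) : ℂ) - 1 / (z + (j + 1))‖ ≤
      (R + 1) * (1 / ((j : ℝ) + 1) ^ 2) := by
  have hm : (0 : ℝ) < (j : ℝ) + 1 := by positivity
  have hmc : ((j : ℂ) + 1) ≠ 0 := by exact_mod_cast hm.ne'
  have h1 : 0 < (z + (j + 1)).re := by simp; positivity
  have hne : z + (j + 1) ≠ 0 := fun h => by rw [h] at h1; simp at h1
  have hn : (j : ℝ) + 1 ≤ ‖z + (j + 1)‖ := by
    refine le_trans ?_ (Complex.re_le_norm _)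
    simp; exact hz.le
  have hlog : |Real.log (j + 2) - Real.log (j + 1) - 1 / (j + 1)| ≤ 1 / ((j : ℝ) + 1) ^ 2 := by
    rw [← Real.log_div (by positivity) (by positivity)]
    have hu := Real.log_le_sub_one_of_pos (x := ((j : ℝ) + 2) / (j + 1)) (by positivity)
    have hl := Real.one_sub_inv_le_log_of_pos (x := ((j : ℝ) + 2) / (j + 1)) (by positivity)
    have e1 : ((j : ℝ) + 2) / (j + 1) - 1 = 1 / (j + 1) := by field_simp; ring
    have e2 : 1 - (((j : ℝ) + 2) / (j + 1))⁻¹ = 1 / (j + 2) := by field_simp; ring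
    have e3 : (1 : ℝ) / (j + 1) - 1 / (j + 2) ≤ 1 / ((j : ℝ) + 1) ^ 2 := by
      have : (1 : ℝ) / (j + 1) - 1 / (j + 2) = 1 / ((j + 1) * (j + 2)) := by field_simp; ring
      rw [this]
      apply one_div_le_one_div_of_le (by positivity)
      nlinarith
    have e4 : (0 : ℝ) ≤ 1 / ((j : ℝ) + 1) ^ 2 := by positivity
    rw [e1] at hu
    rw [e2] at hl
    rw [abs_le]
    constructor <;> linarith
  have hinv : ‖(1 : ℂ) / (j + 1) - 1 / (z + (j + 1))‖ ≤ R * (1 / ((j : ℝ) + 1) ^ 2) := by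
    have : (1 : ℂ) / (j + 1) - 1 / (z + (j + 1)) = z / ((j + 1) * (z + (j + 1))) := by
      field_simp; ring
    rw [this, norm_div, norm_mul, div_eq_mul_one_div]
    have hc : ‖((j : ℂ) + 1)‖ = (j : ℝ) + 1 := by
      exact_mod_cast Complex.norm_natCast (j + 1)
    rw [hc]
    apply mul_le_mul hR _ (by positivity) ((norm_nonneg z).trans hR)
    apply one_div_le_one_div_of_le (by positivity)
    nlinarith
  have hsplit : ((Real.log (j + 2) - Real.log (j + 1) : ℝ) : ℂ) - 1 / (z + (j + 1)) =
      ((Real.log (j + 2) - Real.log (j + 1) - 1 / (j + 1) : ℝ) : ℂ) +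
        ((1 : ℂ) / (j + 1) - 1 / (z + (j + 1))) := by
    push_cast; ring
  rw [hsplit]
  refine (norm_add_le _ _).trans ?_
  rw [Complex.norm_real, Real.norm_eq_abs]
  linarith

theorem summable_one_div_add_one_sq (R : ℝ) :
    Summable fun j : ℕ => (R + 1) * (1 / ((j : ℝ) + 1) ^ 2) := by
  apply Summable.mul_left
  exact_mod_cast (summable_nat_add_iff 1).mpr (Real.summable_one_div_nat_pow.mpr one_lt_two)

/-- The bounded half discs on which the series of logarithms converges uniformly. -/
def halfDisc (R : ℝ) : Set ℂ := Metric.ball 0 R ∩ {z | 0 < z.re}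

theorem isOpen_halfDisc (R : ℝ) : IsOpen (halfDisc R) :=
  Metric.isOpen_ball.inter (isOpen_lt continuous_const Complex.continuous_re)

theorem isPreconnected_halfDisc (R : ℝ) : IsPreconnected (halfDisc R) :=
  ((convex_ball 0 R).inter (convex_halfSpace_re_gt 0)).isPreconnected

/-- This is the base point at which convergence is known; the derivative bounds carry it to the
whole half disc. -/
theorem logGammaTerm_one (j : ℕ) : logGammaTerm j 1 = 0 := by
  have h : (1 : ℂ) + (j + 1) = (((j : ℝ) + 2 : ℝ) : ℂ) := by push_cast; ring
  rw [logGammaTerm, h, ← Complex.ofReal_log (by positivity)]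
  push_cast; ring

theorem mem_halfDisc {z : ℂ} (hz : 0 < z.re) : z ∈ halfDisc (‖z‖ + 2) := by
  refine ⟨?_, hz⟩
  simp

theorem one_mem_halfDisc (z : ℂ) : (1 : ℂ) ∈ halfDisc (‖z‖ + 2) := by
  refine ⟨?_, by simp⟩
  simp only [mem_ball_zero_iff, norm_one]
  linarith [norm_nonneg z]

theorem summable_logGammaTerm {z : ℂ} (hz : 0 < z.re) : Summable fun j => logGammaTerm j z := by
  refine summable_of_summable_hasDerivAt_of_isPreconnected
    (summable_one_div_add_one_sq (‖z‖ + 2)) (isOpen_halfDisc (‖z‖ + 2))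
    (isPreconnected_halfDisc _) (fun j y hy => hasDerivAt_logGammaTerm j hy.2)
    (fun j y hy => norm_deriv_logGammaTerm_le j hy.2 (mem_ball_zero_iff.mp hy.1).le)
    (one_mem_halfDisc z) ?_ (mem_halfDisc hz)
  simp [logGammaTerm_one, summable_zero]

theorem hasDerivAt_tsum_logGammaTerm {z : ℂ} (hz : 0 < z.re) :
    HasDerivAt (fun y => ∑' j, logGammaTerm j y)
      (∑' j : ℕ, (((Real.log (j + 2) - Real.log (j + 1) : ℝ) : ℂ) - 1 / (z + (j + 1)))) z := by
  refine hasDerivAt_tsum_of_isPreconnected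
    (summable_one_div_add_one_sq (‖z‖ + 2)) (isOpen_halfDisc (‖z‖ + 2))
    (isPreconnected_halfDisc _) (fun j y hy => hasDerivAt_logGammaTerm j hy.2)
    (fun j y hy => norm_deriv_logGammaTerm_le j hy.2 (mem_ball_zero_iff.mp hy.1).le)
    (one_mem_halfDisc z) ?_ (mem_halfDisc hz)
  simp [logGammaTerm_one, summable_zero]

theorem exp_sum_logGammaTerm {z : ℂ} (hz : 0 < z.re) (n : ℕ) :
    Complex.exp (∑ j ∈ range n, logGammaTerm j z) =
      ((n : ℂ) + 1) ^ z * (n.factorial : ℂ) / ∏ j ∈ range n, (z + (j + 1)) := by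
  induction n with
  | zero => simp
  | succ n ih =>
    have h1 : 0 < (z + (n + 1)).re := by simp; positivity
    have hne : z + (n + 1) ≠ 0 := fun h => by rw [h] at h1; simp at h1
    have hn1 : ((n : ℂ) + 1) ≠ 0 := by exact_mod_cast n.succ_ne_zero
    have hn2 : ((n : ℂ) + 2) ≠ 0 := by exact_mod_cast (n + 1).succ_ne_zero
    have l1 : ((Real.log (n + 1) : ℝ) : ℂ) = Complex.log ((n : ℂ) + 1) := by
      rw [Complex.ofReal_log (by positivity)]; push_cast; rfl
    have l2 : ((Real.log (n + 2) : ℝ) : ℂ) = Complex.log ((n : ℂ) + 2) := by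
      rw [Complex.ofReal_log (by positivity)]; push_cast; rfl
    have ht : Complex.exp (logGammaTerm n z) =
        ((n : ℂ) + 2) ^ z / ((n : ℂ) + 1) ^ z * (((n : ℂ) + 1) / (z + (n + 1))) := by
      rw [logGammaTerm, Complex.ofReal_sub, l1, l2, Complex.cpow_def_of_ne_zero hn1,
        Complex.cpow_def_of_ne_zero hn2, Complex.exp_sub, Complex.exp_sub, Complex.exp_log hne,
        Complex.exp_log hn1, mul_sub, Complex.exp_sub, mul_comm z, mul_comm z]
      field_simp
    have hc : ((n : ℂ) + 1) ^ z ≠ 0 := by simp [Complex.cpow_eq_zero_iff, hn1]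
    have hp : ∏ j ∈ range n, (z + ((j : ℂ) + 1)) ≠ 0 := by
      refine prod_ne_zero_iff.mpr fun j _ h => ?_
      have h1 : 0 < (z + (j + 1)).re := by simp; positivity
      rw [h] at h1; simp at h1
    rw [sum_range_succ, Complex.exp_add, ih, ht, prod_range_succ, Nat.factorial_succ]
    push_cast
    rw [show (n : ℂ) + 1 + 1 = n + 2 by ring]
    field_simp

/-- Exponentiated partial sums are Euler's products for `Γ` up to a factor tending to 1. Working
with exponentials avoids any choice of branch for `log Γ`. -/
theorem exp_sum_logGammaTerm_eq_GammaSeq {z : ℂ} (hz : 0 < z.re) (n : ℕ) :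
    Complex.exp (∑ j ∈ range n, logGammaTerm j z) =
      z * Complex.GammaSeq z (n + 1) * (1 + z / ((n + 1 : ℕ) : ℂ)) := by
  have hp (m : ℕ) : ∏ j ∈ range m, (z + ((j : ℂ) + 1)) ≠ 0 := by
    refine prod_ne_zero_iff.mpr fun j _ h => ?_
    have h1 : 0 < (z + (j + 1)).re := by simp; positivity
    rw [h] at h1; simp at h1
  have hz0 : z ≠ 0 := fun h => by rw [h] at hz; simp at hz
  have hn1 : ((n : ℂ) + 1) ≠ 0 := by exact_mod_cast n.succ_ne_zero
  rw [exp_sum_logGammaTerm hz, Complex.GammaSeq, prod_range_succ']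
  have h2 := hp (n + 1)
  rw [prod_range_succ] at h2
  push_cast
  rw [prod_range_succ, Nat.factorial_succ]
  have h3 := right_ne_zero_of_mul h2
  have h4 := left_ne_zero_of_mul h2
  push_cast
  rw [add_zero]
  field_simp
  ring

theorem exp_tsum_logGammaTerm {z : ℂ} (hz : 0 < z.re) :
    Complex.exp (∑' j, logGammaTerm j z) = z * Complex.Gamma z := by
  have h1 := (Complex.continuous_exp.tendsto _).comp
    (summable_logGammaTerm hz).hasSum.tendsto_sum_nat
  have h2 : Tendsto (fun n : ℕ => z * Complex.GammaSeq z (n + 1) * (1 + z / ((n + 1 : ℕ) : ℂ)))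
      atTop (𝓝 (z * Complex.Gamma z * (1 + 0))) := by
    refine Tendsto.mul (((Complex.GammaSeq_tendsto_Gamma z).comp
      (tendsto_add_atTop_nat 1)).const_mul z) (Tendsto.const_add 1 ?_)
    exact (tendsto_const_div_atTop_nhds_zero_nat z).comp (tendsto_add_atTop_nat 1)
  rw [add_zero, mul_one] at h2
  refine tendsto_nhds_unique (h1.congr fun n => ?_) h2
  exact exp_sum_logGammaTerm_eq_GammaSeq hz n

/-- The digamma function on the right half plane as a series. -/
theorem digamma_eq_tsum {z : ℂ} (hz : 0 < z.re) :
    Complex.digamma z =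
      (∑' j : ℕ, (((Real.log (j + 2) - Real.log (j + 1) : ℝ) : ℂ) - 1 / (z + (j + 1)))) - 1 / z := by
  have hz0 : z ≠ 0 := fun h => by rw [h] at hz; simp at hz
  have hG : Complex.Gamma z ≠ 0 := Complex.Gamma_ne_zero_of_re_pos hz
  have hd : DifferentiableAt ℂ Complex.Gamma z := by
    refine Complex.differentiableAt_Gamma z fun m h => ?_
    rw [h] at hz
    simp at hz
    linarith [(Nat.cast_nonneg m : (0 : ℝ) ≤ m)]
  have h1 := (hasDerivAt_tsum_logGammaTerm hz).cexp
  have h2 := (hasDerivAt_id z).mul hd.hasDerivAt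
  have he : (fun y => Complex.exp (∑' j, logGammaTerm j y)) =ᶠ[𝓝 z]
      (id * Complex.Gamma : ℂ → ℂ) := by
    filter_upwards [(isOpen_lt continuous_const Complex.continuous_re).mem_nhds hz] with y hy
    exact exp_tsum_logGammaTerm hy
  have h3 := (h2.congr_of_eventuallyEq he).unique h1
  rw [exp_tsum_logGammaTerm hz] at h3
  rw [Complex.digamma_def, logDeriv_apply]
  simp only [id] at h3
  field_simp
  linear_combination h3

theorem summable_deriv_logGammaTerm {z : ℂ} (hz : 0 < z.re) : Summable fun j : ℕ =>
    (((Real.log (j + 2) - Real.log (j + 1) : ℝ) : ℂ) - 1 / (z + (j + 1))) :=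
  Summable.of_norm_bounded (summable_one_div_add_one_sq ‖z‖)
    fun j => norm_deriv_logGammaTerm_le j hz le_rfl

/-- The logarithms do not depend on the argument and cancel in the difference; the separate `1/z` in
`digamma_eq_tsum` is the term `j = 0`. -/
theorem hasSum_digamma_sub {z w : ℂ} (hz : 0 < z.re) (hw : 0 < w.re) :
    HasSum (fun j : ℕ => 1 / (w + j) - 1 / (z + j))
      (Complex.digamma z - Complex.digamma w) := by
  rw [← hasSum_nat_add_iff' 1, digamma_eq_tsum hz, digamma_eq_tsum hw]
  have h := (summable_deriv_logGammaTerm hz).hasSum.sub (summable_deriv_logGammaTerm hw).hasSum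
  convert h using 1
  · funext j; push_cast; ring
  · simp; ring

theorem digamma_three : Complex.digamma 3 = 3 / 2 - (Real.eulerMascheroniConstant : ℂ) := by
  have h1 : Complex.digamma (1 + 1) = Complex.digamma 1 + 1⁻¹ := by
    refine Complex.digamma_apply_add_one 1 fun m h => ?_
    have := congrArg Complex.re h
    simp at this
    linarith [(Nat.cast_nonneg m : (0 : ℝ) ≤ m)]
  have h2 : Complex.digamma (2 + 1) = Complex.digamma 2 + 2⁻¹ := by
    refine Complex.digamma_apply_add_one 2 fun m h => ?_
    have := congrArg Complex.re h
    simp at this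
    linarith [(Nat.cast_nonneg m : (0 : ℝ) ≤ m)]
  rw [show (3 : ℂ) = 2 + 1 by norm_num, h2, show (2 : ℂ) = 1 + 1 by norm_num, h1,
    Complex.digamma_one]
  norm_num
  ring

/-! ### Triangles in the plane: membership, null boundaries, area -/

/-- Twice the signed area of the triangle with the vertices `a`, `b`, `c`. -/
def cross (a b c : ℝ × ℝ) : ℝ :=
  (b.1 - a.1) * (c.2 - a.2) - (b.2 - a.2) * (c.1 - a.1)

theorem affineIndependent_of_cross_pos {a b c : ℝ × ℝ} (h : 0 < cross a b c) :
    AffineIndependent ℝ ![a, b, c] := by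
  rw [affineIndependent_iff_of_fintype]
  intro w hw hs
  rw [Finset.weightedVSub_eq_linear_combination _ hw] at hs
  simp only [Fin.sum_univ_three] at hw hs
  have h1 := congrArg Prod.fst hs
  have h2 := congrArg Prod.snd hs
  simp at h1 h2
  have hw0 : w 0 = -w 1 - w 2 := by linarith
  rw [hw0] at h1 h2
  -- Cramer's rule for the two coordinate equations, whose determinant is `cross a b c`.
  have e1 : w 1 * cross a b c = 0 := by
    rw [cross]; linear_combination (c.2 - a.2) * h1 - (c.1 - a.1) * h2
  have e2 : w 2 * cross a b c = 0 := by
    rw [cross]; linear_combination (b.1 - a.1) * h2 - (b.2 - a.2) * h1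
  have f1 := (mul_eq_zero.mp e1).resolve_right h.ne'
  have f2 := (mul_eq_zero.mp e2).resolve_right h.ne'
  intro i
  fin_cases i
  · simp [hw0, f1, f2]
  · exact f1
  · exact f2

/-- The positively oriented triangle with the vertices `a`, `b`, `c`. -/
noncomputable def tri (a b c : ℝ × ℝ) (h : 0 < cross a b c) : Affine.Triangle ℝ (ℝ × ℝ) :=
  ⟨![a, b, c], affineIndependent_of_cross_pos h⟩

theorem mem_closedInterior_tri_iff_exists {a b c : ℝ × ℝ} (h : 0 < cross a b c) {x : ℝ × ℝ} :
    x ∈ (tri a b c h).closedInterior ↔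
      ∃ s t : ℝ, 0 ≤ s ∧ 0 ≤ t ∧ s + t ≤ 1 ∧ x = a + (s • (b - a) + t • (c - a)) := by
  have key (w : Fin 3 → ℝ) (hw : ∑ i, w i = 1) :
      univ.affineCombination ℝ (tri a b c h).points w =
        a + (w 1 • (b - a) + w 2 • (c - a)) := by
    rw [Finset.affineCombination_eq_linear_combination _ _ _ hw]
    simp only [Fin.sum_univ_three] at hw ⊢
    rw [show w 0 = 1 - w 1 - w 2 by linarith]
    simp only [tri, Matrix.cons_val]
    module
  constructor
  · rintro ⟨w, hw, hI, rfl⟩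
    refine ⟨w 1, w 2, (hI 1).1, (hI 2).1, ?_, key w hw⟩
    have := (hI 0).1
    rw [Fin.sum_univ_three] at hw
    linarith
  · rintro ⟨s, t, hs, ht, hst, rfl⟩
    have hw : ∑ i, ![1 - s - t, s, t] i = 1 := by
      simp [Fin.sum_univ_three]; ring
    refine ⟨![1 - s - t, s, t], hw, fun i => ?_, by simpa using key _ hw⟩
    fin_cases i <;> constructor <;> simp <;> linarith

theorem mem_closedInterior_tri {a b c : ℝ × ℝ} (h : 0 < cross a b c) {x : ℝ × ℝ} :
    x ∈ (tri a b c h).closedInterior ↔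
      0 ≤ cross a b x ∧ 0 ≤ cross b c x ∧ 0 ≤ cross c a x := by
  rw [mem_closedInterior_tri_iff_exists]
  constructor
  · rintro ⟨s, t, hs, ht, hst, rfl⟩
    refine ⟨?_, ?_, ?_⟩
    · have : cross a b (a + (s • (b - a) + t • (c - a))) = t * cross a b c := by
        simp [cross]; ring
      rw [this]; positivity
    · have : cross b c (a + (s • (b - a) + t • (c - a))) = (1 - s - t) * cross a b c := by
        simp [cross]; ring
      rw [this]; exact mul_nonneg (by linarith) h.le
    · have : cross c a (a + (s • (b - a) + t • (c - a))) = s * cross a b c := by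
        simp [cross]; ring
      rw [this]; positivity
  · rintro ⟨h1, h2, h3⟩
    refine ⟨cross c a x / cross a b c, cross a b x / cross a b c, by positivity, by positivity,
      ?_, ?_⟩
    · rw [← add_div, div_le_one h]
      simp only [cross] at *
      linarith
    · ext
      · simp only [Prod.fst_add, Prod.smul_fst, Prod.fst_sub, smul_eq_mul]
        field_simp
        simp only [cross]; ring
      · simp only [Prod.snd_add, Prod.smul_snd, Prod.snd_sub, smul_eq_mul]
        field_simp
        simp only [cross]; ring

/-- Lets strict and weak inequalities be interchanged almost everywhere when regions are compared
with closed triangles. -/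
theorem ae_line_ne {a b : ℝ} (c : ℝ) (h : a ≠ 0 ∨ b ≠ 0) :
    ∀ᵐ x : ℝ × ℝ, a * x.1 + b * x.2 ≠ c := by
  have hm : MeasurableSet {x : ℝ × ℝ | a * x.1 + b * x.2 = c} :=
    measurableSet_eq_fun (by fun_prop) (by fun_prop)
  have : volume {x : ℝ × ℝ | a * x.1 + b * x.2 = c} = 0 := by
    rw [Measure.volume_eq_prod, Measure.measure_prod_null hm]
    by_cases hb : b = 0
    · have ha : a ≠ 0 := by simpa [hb] using h
      filter_upwards [Measure.ae_ne volume (c / a)] with x hx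
      have : Prod.mk x ⁻¹' {x : ℝ × ℝ | a * x.1 + b * x.2 = c} = ∅ := by
        ext y
        simp only [Set.mem_preimage, Set.mem_ofPred_eq, Set.mem_empty_iff_false, iff_false, hb]
        intro hy
        exact hx (by field_simp; linarith)
      simp [this]
    · filter_upwards with x
      have : Prod.mk x ⁻¹' {x : ℝ × ℝ | a * x.1 + b * x.2 = c} ⊆ {(c - a * x) / b} := by
        intro y hy
        simp only [Set.mem_preimage, Set.mem_ofPred_eq] at hy
        simp only [Set.mem_singleton_iff]
        field_simp
        linarith
      exact measure_mono_null this (by simp)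
  simpa [ae_iff] using this

theorem volume_standardTriangle :
    volume {x : ℝ × ℝ | 0 ≤ x.1 ∧ 0 ≤ x.2 ∧ x.1 + x.2 ≤ 1} = ENNReal.ofReal (1 / 2) := by
  have h1 : {x : ℝ × ℝ | 0 ≤ x.1 ∧ 0 ≤ x.2 ∧ x.1 + x.2 ≤ 1} =ᵐ[volume]
      regionBetween (fun _ => (0 : ℝ)) (fun x => 1 - x) (Set.Ioc 0 1) := by
    filter_upwards [ae_line_ne (a := 1) (b := 0) 0 (by simp),
      ae_line_ne (a := 0) (b := 1) 0 (by simp), ae_line_ne (a := 1) (b := 1) 1 (by simp)]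
      with x h1 h2 h3
    apply propext
    change (0 ≤ x.1 ∧ 0 ≤ x.2 ∧ x.1 + x.2 ≤ 1) ↔ x.1 ∈ Set.Ioc 0 1 ∧ x.2 ∈ Set.Ioo 0 (1 - x.1)
    simp only [Set.mem_Ioc, Set.mem_Ioo]
    simp only [zero_mul, one_mul, add_zero, zero_add] at h1 h2 h3
    constructor
    · rintro ⟨a1, a2, a3⟩
      have b1 := lt_of_le_of_ne a1 (Ne.symm h1)
      have b2 := lt_of_le_of_ne a2 (Ne.symm h2)
      have b3 := lt_of_le_of_ne a3 h3
      exact ⟨⟨b1, by linarith⟩, b2, by linarith⟩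
    · rintro ⟨⟨a1, a2⟩, a3, a4⟩
      exact ⟨a1.le, a3.le, by linarith⟩
  rw [measure_congr h1, Measure.volume_eq_prod,
    volume_regionBetween_eq_integral (by simp)
      (ContinuousOn.integrableOn_Icc (by fun_prop) |>.mono_set Set.Ioc_subset_Icc_self)
      measurableSet_Ioc (fun x hx => by simpa using hx.2)]
  congr 1
  rw [← intervalIntegral.integral_of_le zero_le_one]
  simp [intervalIntegral.integral_comp_sub_left (fun x => x)]

theorem volume_tri {a b c : ℝ × ℝ} (h : 0 < cross a b c) :
    volume (tri a b c h).closedInterior = ENNReal.ofReal (cross a b c / 2) := by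
  let M : Matrix (Fin 2) (Fin 2) ℝ := !![b.1 - a.1, c.1 - a.1; b.2 - a.2, c.2 - a.2]
  let f : ℝ × ℝ →ₗ[ℝ] ℝ × ℝ :=
    Matrix.toLin (Module.Basis.finTwoProd ℝ) (Module.Basis.finTwoProd ℝ) M
  have hf (v : ℝ × ℝ) : f v = v.1 • (b - a) + v.2 • (c - a) := by
    simp only [f, M, Matrix.toLin_finTwoProd_apply]
    ext <;> simp <;> ring
  have hdet : LinearMap.det f = cross a b c := by
    simp only [f, LinearMap.det_toLin, M, Matrix.det_fin_two_of, cross]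
    ring
  have hset : (tri a b c h).closedInterior = (fun v => a + v) ''
      (f '' {x : ℝ × ℝ | 0 ≤ x.1 ∧ 0 ≤ x.2 ∧ x.1 + x.2 ≤ 1}) := by
    ext x
    rw [mem_closedInterior_tri_iff_exists]
    constructor
    · rintro ⟨s, t, hs, ht, hst, rfl⟩
      exact ⟨_, ⟨(s, t), ⟨hs, ht, hst⟩, rfl⟩, by simp [hf]⟩
    · rintro ⟨_, ⟨v, ⟨hs, ht, hst⟩, rfl⟩, rfl⟩
      exact ⟨v.1, v.2, hs, ht, hst, by simp [hf]⟩
  rw [hset, Set.image_add_left, measure_preimage_add, Measure.addHaar_image_linearMap, hdet,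
    volume_standardTriangle, ← ENNReal.ofReal_mul (abs_nonneg _), abs_of_pos h]
  congr 1; ring

theorem volume_real_tri {a b c : ℝ × ℝ} (h : 0 < cross a b c) :
    volume.real (tri a b c h).closedInterior = cross a b c / 2 := by
  rw [measureReal_def, volume_tri, ENNReal.toReal_ofReal (by positivity)]

theorem measurableSet_tri {a b c : ℝ × ℝ} (h : 0 < cross a b c) :
    MeasurableSet (tri a b c h).closedInterior := by
  have : (tri a b c h).closedInterior =
      {x | 0 ≤ cross a b x} ∩ ({x | 0 ≤ cross b c x} ∩ {x | 0 ≤ cross c a x}) := by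
    ext x; exact mem_closedInterior_tri h
  rw [this]
  have (u v : ℝ × ℝ) : MeasurableSet {x | 0 ≤ cross u v x} :=
    measurableSet_le measurable_const (by unfold cross; fun_prop)
  exact (this _ _).inter ((this _ _).inter (this _ _))

/-! ### The bounds as linear inequalities -/

theorem upperBound_le_iff {x : ℝ × ℝ} (hx : x ∈ T) (n : ℤ) :
    upperBound x.1 x.2 ≤ n ↔ 1 - x.2 ≤ n * (x.2 - x.1) := by
  obtain ⟨h0, h1, h2⟩ := hx
  rw [upperBound, Int.ceil_le, max_eq_left (by linarith), div_le_iff₀ (by linarith)]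

theorem le_linearLowerBound_iff {x : ℝ × ℝ} (hx : x ∈ T) (n : ℤ) :
    n ≤ linearLowerBound x.1 x.2 ↔ ((n : ℝ) - 1) * (x.2 - x.1 / 2) < 1 - x.2 := by
  obtain ⟨h0, h1, h2⟩ := hx
  rw [linearLowerBound, Int.le_ceil_iff, lt_div_iff₀ (by linarith)]

theorem le_generalLowerBound_iff {x : ℝ × ℝ} (hx : x ∈ T) (n : ℤ) :
    n ≤ generalLowerBound x.1 x.2 ↔ (2 * (n : ℝ) - 1) * (x.2 - x.1) ≤ 1 := by
  obtain ⟨h0, h1, h2⟩ := hx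
  have hd : 0 < x.2 - x.1 := by linarith
  rw [generalLowerBound, Int.le_floor, ← sub_le_iff_le_add, le_div_iff₀ (by linarith)]
  constructor <;> intro h <;> linarith

theorem one_le_upperBound {x : ℝ × ℝ} (hx : x ∈ T) : 1 ≤ upperBound x.1 x.2 := by
  by_contra h
  have h' : upperBound x.1 x.2 ≤ 0 := by omega
  rw [upperBound_le_iff hx] at h'
  obtain ⟨h0, h1, h2⟩ := hx
  push_cast at h'
  linarith

/-- With `u = U` one has `1 - p ≤ u(p-q)`. A linear bound above `u` would give `u(p - q/2) < 1 - p`,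
impossible for `q > 0`. A general bound above `u` would give `(2u+1)(p-q) ≤ 1`, whence `p + q ≥ 1`.
-/
theorem combinedLowerBound_le_upperBound {x : ℝ × ℝ} (hx : x ∈ T) :
    combinedLowerBound x.1 x.2 ≤ upperBound x.1 x.2 := by
  have h1 := one_le_upperBound hx
  have hu := (upperBound_le_iff hx _).mp le_rfl
  refine max_le ?_ ?_
  · by_contra! h
    have hl := (le_linearLowerBound_iff hx _).mp (Int.add_one_le_of_lt h)
    obtain ⟨a, b, c⟩ := hx
    have h1' : (1 : ℝ) ≤ upperBound x.1 x.2 := by exact_mod_cast h1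
    push_cast at hl
    nlinarith
  · by_contra! h
    have hl := (le_generalLowerBound_iff hx _).mp (Int.add_one_le_of_lt h)
    obtain ⟨a, b, c⟩ := hx
    push_cast at hl
    nlinarith

theorem mem_agreementLevel_iff {x : ℝ × ℝ} (n : ℕ) :
    x ∈ agreementLevel n ↔ x ∈ T ∧ 1 ≤ (n + 1) * x.2 - n * x.1 ∧
      (n * x.2 - (n - 1) * x.1 / 2 < 1 ∨ (2 * (n : ℝ) - 1) * (x.2 - x.1) ≤ 1) := by
  refine and_congr_right fun hx => ?_
  have hle := combinedLowerBound_le_upperBound hx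
  have h1 : (upperBound x.1 x.2 = n ∧ combinedLowerBound x.1 x.2 = n) ↔
      (upperBound x.1 x.2 ≤ n ∧ (n : ℤ) ≤ combinedLowerBound x.1 x.2) := by
    constructor <;> rintro ⟨h, h'⟩ <;> constructor <;> omega
  rw [h1, upperBound_le_iff hx, combinedLowerBound, le_max_iff, le_linearLowerBound_iff hx,
    le_generalLowerBound_iff hx]
  push_cast
  refine and_congr ⟨fun h => by linarith, fun h => by linarith⟩ (or_congr_left ?_)
  exact ⟨fun h => by linarith, fun h => by linarith⟩

/-! ### Triangulation of the agreement levels -/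

theorem exists_triangles_of_single {S : Set (ℝ × ℝ)} {a b c : ℝ × ℝ} (h : 0 < cross a b c)
    (hS : S =ᵐ[volume] (tri a b c h).closedInterior) :
    ∃ F : Finset (Affine.Triangle ℝ (ℝ × ℝ)), S =ᵐ[volume] ⋃ t ∈ F, t.closedInterior ∧
      ∑ t ∈ F, volume.real t.closedInterior = cross a b c / 2 ∧
      volume S = ENNReal.ofReal (cross a b c / 2) := by
  refine ⟨{tri a b c h}, by simpa using hS, ?_, ?_⟩
  · rw [sum_singleton, volume_real_tri]
  · rw [measure_congr hS, volume_tri]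

theorem exists_triangles_of_pair {S : Set (ℝ × ℝ)} {a b c a' b' c' : ℝ × ℝ}
    (h : 0 < cross a b c) (h' : 0 < cross a' b' c')
    (hS : ∀ᵐ x : ℝ × ℝ, x ∈ S ↔
      x ∈ (tri a b c h).closedInterior ∨ x ∈ (tri a' b' c' h').closedInterior)
    (hd : ∀ᵐ x : ℝ × ℝ,
      ¬(x ∈ (tri a b c h).closedInterior ∧ x ∈ (tri a' b' c' h').closedInterior)) :
    ∃ F : Finset (Affine.Triangle ℝ (ℝ × ℝ)), S =ᵐ[volume] ⋃ t ∈ F, t.closedInterior ∧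
      ∑ t ∈ F, volume.real t.closedInterior = cross a b c / 2 + cross a' b' c' / 2 ∧
      volume S = ENNReal.ofReal (cross a b c / 2 + cross a' b' c' / 2) := by
  classical
  have hdis : AEDisjoint volume (tri a b c h).closedInterior
      (tri a' b' c' h').closedInterior := by
    simpa [ae_iff, AEDisjoint] using! hd
  -- Equal triangles would be almost disjoint from themselves, hence null. Distinctness keeps the
  -- two-element `Finset` from collapsing in the sum.
  have hne : tri a b c h ≠ tri a' b' c' h' := by
    intro he
    rw [← he, AEDisjoint, Set.inter_self, volume_tri, ENNReal.ofReal_eq_zero] at hdis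
    linarith
  have hS' : S =ᵐ[volume] ((tri a b c h).closedInterior ∪
      (tri a' b' c' h').closedInterior : Set (ℝ × ℝ)) := by
    filter_upwards [hS] with x hx using propext hx
  refine ⟨{tri a b c h, tri a' b' c' h'}, by simpa using hS', ?_, ?_⟩
  · rw [sum_pair hne, volume_real_tri, volume_real_tri]
  · rw [measure_congr hS', measure_union₀ (measurableSet_tri h').nullMeasurableSet hdis,
      volume_tri, volume_tri, ENNReal.ofReal_add (by positivity) (by positivity)]

/-- The area of the region where both bounds are equal to `n`. -/
noncomputable def levelArea (n : ℕ) : ℝ :=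
  if n = 0 then 0 else if n = 1 then 1 / 12 else if n = 2 then 1 / 30 + 1 / 135 else
    1 / (n * (n + 1) * (n ^ 2 + 1)) + 1 / ((2 * n + 1) * (2 * n - 1) ^ 2)

/-- The statement that `S` is up to a null set a finite union of triangles whose areas have the
sum `A`, and that `A` is the area of `S`. -/
def HasTriangulation (S : Set (ℝ × ℝ)) (A : ℝ) : Prop :=
  ∃ F : Finset (Affine.Triangle ℝ (ℝ × ℝ)), S =ᵐ[volume] ⋃ t ∈ F, t.closedInterior ∧
    ∑ t ∈ F, volume.real t.closedInterior = A ∧ volume S = ENNReal.ofReal A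

theorem hasTriangulation_level_zero : HasTriangulation (agreementLevel 0) (levelArea 0) := by
  have : agreementLevel 0 = ∅ := by
    ext x
    simp only [Set.mem_empty_iff_false, iff_false]
    rintro ⟨hx, h, -⟩
    have := one_le_upperBound hx
    push_cast at h
    omega
  exact ⟨∅, by simp [this], by simp [levelArea], by simp [this, levelArea]⟩

theorem hasTriangulation_T : HasTriangulation T (1 / 4) := by
  have h : 0 < cross (0, 0) (1 / 2, 1 / 2) (0, 1) := by norm_num [cross]
  have hA : cross (0, 0) (1 / 2, 1 / 2) (0, 1) / 2 = 1 / 4 := by norm_num [cross]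
  rw [← hA]
  refine exists_triangles_of_single h ?_
  filter_upwards [ae_line_ne (a := 1) (b := 0) 0 (by simp),
    ae_line_ne (a := -1) (b := 1) 0 (by simp), ae_line_ne (a := 1) (b := 1) 1 (by simp)]
    with x h1 h2 h3
  refine propext (Iff.trans ?_ (mem_closedInterior_tri h).symm)
  simp only [cross]
  constructor
  · rintro ⟨a, b, c⟩
    refine ⟨?_, ?_, ?_⟩ <;> linarith
  · rintro ⟨a, b, c⟩
    refine ⟨lt_of_le_of_ne ?_ fun e => h1 ?_, lt_of_le_of_ne ?_ fun e => h2 ?_,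
      lt_of_le_of_ne ?_ fun e => h3 ?_⟩ <;> linarith

theorem hasTriangulation_level_one : HasTriangulation (agreementLevel 1) (levelArea 1) := by
  have h : 0 < cross (0, 1 / 2) (1 / 3, 2 / 3) (0, 1) := by norm_num [cross]
  have hA : levelArea 1 = cross (0, 1 / 2) (1 / 3, 2 / 3) (0, 1) / 2 := by
    norm_num [cross, levelArea]
  rw [hA]
  refine exists_triangles_of_single h ?_
  filter_upwards [ae_line_ne (a := 1) (b := 0) 0 (by simp),
    ae_line_ne (a := 1) (b := 1) 1 (by simp)]
    with x h1 h3
  refine propext (Iff.trans (mem_agreementLevel_iff 1) (Iff.trans ?_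
    (mem_closedInterior_tri h).symm))
  simp only [cross]
  push_cast
  constructor
  · rintro ⟨⟨a, b, c⟩, d, -⟩
    refine ⟨?_, ?_, ?_⟩ <;> linarith
  · rintro ⟨a, b, c⟩
    have a0 : 0 < x.1 := lt_of_le_of_ne (by linarith) fun e => h1 (by linarith)
    have c0 : x.1 + x.2 < 1 := lt_of_le_of_ne (by linarith) fun e => h3 (by linarith)
    -- For `n = 1` the linear condition is just `p < 1`, which holds throughout `T`.
    exact ⟨⟨a0, by linarith, c0⟩, by linarith, Or.inl (by linarith)⟩

theorem cross_linear_pos {n : ℝ} (hn : 2 ≤ n) :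
    0 < cross (0, 1 / (n + 1)) (2 / (n ^ 2 + 1), (n + 1) / (n ^ 2 + 1)) (0, 1 / n) := by
  have : cross (0, 1 / (n + 1)) (2 / (n ^ 2 + 1), (n + 1) / (n ^ 2 + 1)) (0, 1 / n) =
      2 / (n * (n + 1) * (n ^ 2 + 1)) := by
    simp only [cross]; field_simp; ring
  rw [this]; positivity

/-- Along each edge, `cross` is a positive multiple of the affine form that defines the edge. -/
theorem mem_linear_tri_iff {n : ℝ} (hn : 2 ≤ n) {x : ℝ × ℝ} :
    x ∈ (tri _ _ _ (cross_linear_pos hn)).closedInterior ↔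
      1 ≤ (n + 1) * x.2 - n * x.1 ∧ n * x.2 - (n - 1) * x.1 / 2 ≤ 1 ∧ 0 ≤ x.1 := by
  rw [mem_closedInterior_tri]
  have e1 : cross (0, 1 / (n + 1)) (2 / (n ^ 2 + 1), (n + 1) / (n ^ 2 + 1)) x =
      2 / ((n ^ 2 + 1) * (n + 1)) * ((n + 1) * x.2 - n * x.1 - 1) := by
    simp only [cross]; field_simp; ring
  have e2 : cross (2 / (n ^ 2 + 1), (n + 1) / (n ^ 2 + 1)) (0, 1 / n) x =
      2 / ((n ^ 2 + 1) * n) * (1 - (n * x.2 - (n - 1) * x.1 / 2)) := by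
    simp only [cross]; field_simp; ring
  have e3 : cross (0, 1 / n) (0, 1 / (n + 1)) x = 1 / (n * (n + 1)) * x.1 := by
    simp only [cross]; field_simp; ring
  rw [e1, e2, e3, mul_nonneg_iff_of_pos_left (by positivity),
    mul_nonneg_iff_of_pos_left (by positivity), mul_nonneg_iff_of_pos_left (by positivity),
    sub_nonneg, sub_nonneg]

theorem cross_general_pos {n : ℝ} (hn : 2 ≤ n) :
    0 < cross ((n - 2) / (2 * n - 1), (n - 1) / (2 * n - 1))
      (n / (2 * n + 1), (n + 1) / (2 * n + 1)) ((n - 1) / (2 * n - 1), n / (2 * n - 1)) := by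
  have h1 : 0 < 2 * n - 1 := by linarith
  have h1' : n * 2 - 1 ≠ 0 := by linarith
  have : cross ((n - 2) / (2 * n - 1), (n - 1) / (2 * n - 1))
      (n / (2 * n + 1), (n + 1) / (2 * n + 1)) ((n - 1) / (2 * n - 1), n / (2 * n - 1)) =
      2 / ((2 * n + 1) * (2 * n - 1) ^ 2) := by
    simp only [cross]; field_simp; ring
  rw [this]; positivity

theorem mem_general_tri_iff {n : ℝ} (hn : 2 ≤ n) {x : ℝ × ℝ} :
    x ∈ (tri _ _ _ (cross_general_pos hn)).closedInterior ↔
      1 ≤ (n + 1) * x.2 - n * x.1 ∧ x.1 + x.2 ≤ 1 ∧ (2 * n - 1) * (x.2 - x.1) ≤ 1 := by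
  have h1 : 0 < 2 * n - 1 := by linarith
  have h1' : n * 2 - 1 ≠ 0 := by linarith
  rw [mem_closedInterior_tri]
  have e1 : cross ((n - 2) / (2 * n - 1), (n - 1) / (2 * n - 1))
      (n / (2 * n + 1), (n + 1) / (2 * n + 1)) x =
      2 / ((2 * n + 1) * (2 * n - 1)) * ((n + 1) * x.2 - n * x.1 - 1) := by
    simp only [cross]; field_simp; ring
  have e2 : cross (n / (2 * n + 1), (n + 1) / (2 * n + 1))
      ((n - 1) / (2 * n - 1), n / (2 * n - 1)) x =
      1 / ((2 * n + 1) * (2 * n - 1)) * (1 - (x.1 + x.2)) := by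
    simp only [cross]; field_simp; ring
  have e3 : cross ((n - 1) / (2 * n - 1), n / (2 * n - 1))
      ((n - 2) / (2 * n - 1), (n - 1) / (2 * n - 1)) x =
      1 / (2 * n - 1) ^ 2 * (1 - (2 * n - 1) * (x.2 - x.1)) := by
    simp only [cross]; field_simp; ring
  rw [e1, e2, e3, mul_nonneg_iff_of_pos_left (by positivity),
    mul_nonneg_iff_of_pos_left (by positivity), mul_nonneg_iff_of_pos_left (by positivity),
    sub_nonneg, sub_nonneg, sub_nonneg]

theorem mem_T_of_linear {n : ℝ} (hn : 2 ≤ n) {x : ℝ × ℝ} (hq : 0 < x.1)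
    (hl : 1 ≤ (n + 1) * x.2 - n * x.1) (hm : n * x.2 - (n - 1) * x.1 / 2 < 1) : x ∈ T := by
  refine ⟨hq, ?_, ?_⟩
  · have := mul_pos (show 0 < n - 1 by linarith) hq
    linarith
  · have h1 := mul_nonneg (show 0 ≤ n - 1 by linarith) (sub_nonneg.mpr hl)
    have h2 := mul_pos (show 0 < n by linarith) (sub_pos.mpr hm)
    -- The coefficient vanishes at `n = 2`, where the apex `(2/5, 3/5)` lies on `p + q = 1`.
    have h3 := mul_nonneg (show 0 ≤ n * (n - 1) / 2 - 1 by nlinarith) hq.le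
    linarith

theorem mem_T_of_general {n : ℝ} (hn : 2 ≤ n) {x : ℝ × ℝ} (hs : x.1 + x.2 < 1)
    (hl : 1 ≤ (n + 1) * x.2 - n * x.1) (hd : (2 * n - 1) * (x.2 - x.1) < 1) : x ∈ T := by
  refine ⟨?_, ?_, hs⟩
  · have h1 := mul_nonneg (show 0 ≤ n - 1 by linarith) (sub_nonneg.mpr hl)
    have h2 := mul_pos (show 0 < n by linarith) (sub_pos.mpr hd)
    have h3 := mul_nonneg (show 0 ≤ n - 2 by linarith) (sub_pos.mpr hs).le
    linarith
  · linarith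

/-- Together with `hl`, the linear condition forces `q < 2/(n²+1)` and the general one `q >
(n-2)/(2n-1)`. These conflict because `(n-2)(n²+1) - 2(2n-1) = n(n-3)(n+1) ≥ 0`; at `n = 3` the
closed triangles share a vertex. -/
theorem not_linear_and_general {n : ℝ} (hn : 3 ≤ n) {x : ℝ × ℝ}
    (hl : 1 ≤ (n + 1) * x.2 - n * x.1) (hm : n * x.2 - (n - 1) * x.1 / 2 < 1)
    (hd : (2 * n - 1) * (x.2 - x.1) < 1) : False := by
  have a1 := mul_nonneg (show 0 ≤ n by linarith) (sub_nonneg.mpr hl)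
  have a2 := mul_pos (show 0 < n + 1 by linarith) (sub_pos.mpr hm)
  have a3 := mul_nonneg (show 0 ≤ 2 * n - 1 by linarith) (sub_nonneg.mpr hl)
  have a4 := mul_pos (show 0 < n + 1 by linarith) (sub_pos.mpr hd)
  have b1 : (n ^ 2 + 1) * x.1 < 2 := by linarith
  have b2 : n - 2 < (2 * n - 1) * x.1 := by linarith
  have c1 := mul_lt_mul_of_pos_left b1 (show 0 < 2 * n - 1 by linarith)
  have c2 := mul_lt_mul_of_pos_left b2 (show 0 < n ^ 2 + 1 by positivity)
  have c3 : 0 ≤ n * (n - 3) * (n + 1) :=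
    mul_nonneg (mul_nonneg (by linarith) (by linarith)) (by linarith)
  linarith

theorem ae_linear_ne {n : ℝ} (hn : 2 ≤ n) :
    ∀ᵐ x : ℝ × ℝ, n * x.2 - (n - 1) * x.1 / 2 ≠ 1 := by
  filter_upwards [ae_line_ne (a := -(n - 1) / 2) (b := n) 1 (Or.inr (by linarith))] with x hx h
  exact hx (by linarith)

theorem ae_general_ne {n : ℝ} (hn : 2 ≤ n) :
    ∀ᵐ x : ℝ × ℝ, (2 * n - 1) * (x.2 - x.1) ≠ 1 := by
  filter_upwards [ae_line_ne (a := -(2 * n - 1)) (b := 2 * n - 1) 1 (Or.inr (by linarith))]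
    with x hx h
  exact hx (by linarith)

theorem hasTriangulation_level_two : HasTriangulation (agreementLevel 2) (levelArea 2) := by
  -- What the line `2p - q/2 = 1` leaves of the general triangle; `(2/9, 5/9)` is where it meets
  -- `3(p-q) = 1`.
  have h : 0 < cross (2 / 9, 5 / 9) (2 / 5, 3 / 5) (1 / 3, 2 / 3) := by norm_num [cross]
  have h0 := cross_linear_pos (n := 2) le_rfl
  have hA : levelArea 2 = cross (0, 1 / ((2 : ℝ) + 1)) (2 / ((2 : ℝ) ^ 2 + 1),
      ((2 : ℝ) + 1) / ((2 : ℝ) ^ 2 + 1)) (0, 1 / (2 : ℝ)) / 2 +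
      cross (2 / 9, 5 / 9) (2 / 5, 3 / 5) (1 / 3, 2 / 3) / 2 := by
    norm_num [cross, levelArea]
  rw [hA]
  refine exists_triangles_of_pair h0 h ?_ ?_
  · filter_upwards [ae_line_ne (a := 1) (b := 0) 0 (by simp),
      ae_line_ne (a := 1) (b := 1) 1 (by simp), ae_linear_ne (n := 2) le_rfl,
      ae_general_ne (n := 2) le_rfl] with x h1 h2 h3 h4
    rw [mem_linear_tri_iff le_rfl, mem_closedInterior_tri, mem_agreementLevel_iff]
    simp only [cross]
    push_cast
    constructor
    · rintro ⟨⟨a, b, c⟩, d, e⟩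
      by_cases hm : 2 * x.2 - (2 - 1) * x.1 / 2 < 1
      · exact Or.inl ⟨d, hm.le, a.le⟩
      · have e' := e.resolve_left hm
        refine Or.inr ⟨?_, ?_, ?_⟩ <;> linarith
    · rintro (⟨a, b, c⟩ | ⟨a, b, c⟩)
      · have hq : 0 < x.1 := lt_of_le_of_ne c fun e => h1 (by linarith)
        have hm := lt_of_le_of_ne b h3
        exact ⟨mem_T_of_linear le_rfl hq a hm, a, Or.inl hm⟩
      · have hs : x.1 + x.2 < 1 := lt_of_le_of_ne (by linarith) fun e => h2 (by linarith)
        have hd := lt_of_le_of_ne (show (2 * 2 - 1) * (x.2 - x.1) ≤ 1 by linarith) h4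
        have hl : 1 ≤ (2 + 1) * x.2 - 2 * x.1 := by linarith
        exact ⟨mem_T_of_general le_rfl hs hl hd, hl, Or.inr hd.le⟩
  · filter_upwards [ae_linear_ne (n := 2) le_rfl] with x h3
    rw [mem_linear_tri_iff le_rfl, mem_closedInterior_tri]
    simp only [cross]
    rintro ⟨⟨-, b, -⟩, c, -, -⟩
    exact h3 (le_antisymm b (by linarith))

theorem hasTriangulation_level {n : ℕ} (hn : 3 ≤ n) :
    HasTriangulation (agreementLevel n) (levelArea n) := by
  have hn3 : (3 : ℝ) ≤ n := by exact_mod_cast hn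
  have hn2 : (2 : ℝ) ≤ n := by linarith
  have hpos : (n : ℝ) * 2 - 1 ≠ 0 := by linarith
  have hA : levelArea n = cross (0, 1 / ((n : ℝ) + 1)) (2 / ((n : ℝ) ^ 2 + 1),
      ((n : ℝ) + 1) / ((n : ℝ) ^ 2 + 1)) (0, 1 / (n : ℝ)) / 2 +
      cross (((n : ℝ) - 2) / (2 * n - 1), ((n : ℝ) - 1) / (2 * n - 1))
      ((n : ℝ) / (2 * n + 1), ((n : ℝ) + 1) / (2 * n + 1))
      (((n : ℝ) - 1) / (2 * n - 1), (n : ℝ) / (2 * n - 1)) / 2 := by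
    rw [levelArea, if_neg (by omega), if_neg (by omega), if_neg (by omega)]
    simp only [cross]
    field_simp
    ring
  rw [hA]
  refine exists_triangles_of_pair (cross_linear_pos hn2) (cross_general_pos hn2) ?_ ?_
  · filter_upwards [ae_line_ne (a := 1) (b := 0) 0 (by simp),
      ae_line_ne (a := 1) (b := 1) 1 (by simp), ae_linear_ne hn2, ae_general_ne hn2]
      with x h1 h2 h3 h4
    rw [mem_linear_tri_iff hn2, mem_general_tri_iff hn2, mem_agreementLevel_iff]
    constructor
    · rintro ⟨⟨a, b, c⟩, d, e | e⟩
      · exact Or.inl ⟨d, e.le, a.le⟩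
      · exact Or.inr ⟨d, c.le, e⟩
    · rintro (⟨a, b, c⟩ | ⟨a, b, c⟩)
      · have hq : 0 < x.1 := lt_of_le_of_ne c fun e => h1 (by linarith)
        have hm := lt_of_le_of_ne b h3
        exact ⟨mem_T_of_linear hn2 hq a hm, a, Or.inl hm⟩
      · have hs : x.1 + x.2 < 1 := lt_of_le_of_ne b fun e => h2 (by linarith)
        have hd := lt_of_le_of_ne c h4
        exact ⟨mem_T_of_general hn2 hs a hd, a, Or.inr hd.le⟩
  · filter_upwards [ae_linear_ne hn2, ae_general_ne hn2] with x h3 h4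
    rw [mem_linear_tri_iff hn2, mem_general_tri_iff hn2]
    rintro ⟨⟨a, b, -⟩, -, -, c⟩
    exact not_linear_and_general hn3 a (lt_of_le_of_ne b h3) (lt_of_le_of_ne c h4)

theorem hasTriangulation_agreementLevel (n : ℕ) :
    HasTriangulation (agreementLevel n) (levelArea n) := by
  match n with
  | 0 => exact hasTriangulation_level_zero
  | 1 => exact hasTriangulation_level_one
  | 2 => exact hasTriangulation_level_two
  | n + 3 => exact hasTriangulation_level (by omega)

/-! ### The probability as a sum of areas -/

theorem measurableSet_T : MeasurableSet T := by
  have : T = {x | 0 < x.1} ∩ ({x | x.1 < x.2} ∩ {x | x.1 + x.2 < 1}) := rfl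
  rw [this]
  exact (measurableSet_lt (by fun_prop) (by fun_prop)).inter
    ((measurableSet_lt (by fun_prop) (by fun_prop)).inter
      (measurableSet_lt (by fun_prop) (by fun_prop)))

theorem measurableSet_agreementLevel (n : ℕ) : MeasurableSet (agreementLevel n) := by
  have : agreementLevel n = T ∩ ({x | 1 ≤ (n + 1) * x.2 - n * x.1} ∩
      ({x | n * x.2 - (n - 1) * x.1 / 2 < 1} ∪ {x | (2 * (n : ℝ) - 1) * (x.2 - x.1) ≤ 1})) := by
    ext x; exact mem_agreementLevel_iff n
  rw [this]
  exact measurableSet_T.inter ((measurableSet_le (by fun_prop) (by fun_prop)).inter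
    ((measurableSet_lt (by fun_prop) (by fun_prop)).union
      (measurableSet_le (by fun_prop) (by fun_prop))))

theorem T_inter_agreement : T ∩ agreement = ⋃ n, agreementLevel n := by
  ext x
  simp only [Set.mem_inter_iff, Set.mem_iUnion]
  constructor
  · rintro ⟨hx, he⟩
    have h1 := one_le_upperBound hx
    have h2 : ((upperBound x.1 x.2).toNat : ℤ) = upperBound x.1 x.2 :=
      Int.toNat_of_nonneg (by omega)
    exact ⟨(upperBound x.1 x.2).toNat, hx, h2.symm, he.symm.trans h2.symm⟩
  · rintro ⟨n, hx, h1, h2⟩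
    exact ⟨hx, h1.trans h2.symm⟩

theorem pairwise_disjoint_agreementLevel :
    Pairwise (Function.onFun Disjoint agreementLevel) := by
  intro m n hmn
  refine Set.disjoint_left.mpr fun x hx hy => hmn ?_
  exact_mod_cast hx.2.1.symm.trans hy.2.1

theorem levelArea_nonneg (n : ℕ) : 0 ≤ levelArea n := by
  unfold levelArea
  split_ifs
  · exact le_rfl
  · norm_num
  · norm_num
  · positivity

theorem uniformT_real_agreement {s : ℝ} (hs : HasSum (fun n => 4 * levelArea n) s) :
    uniformT.real agreement = s := by
  have hs' : HasSum levelArea (s / 4) := by simpa using hs.div_const 4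
  have h0 : 0 ≤ s / 4 := hs'.nonneg levelArea_nonneg
  have hv : volume (T ∩ agreement) = ENNReal.ofReal (s / 4) := by
    rw [T_inter_agreement, measure_iUnion pairwise_disjoint_agreementLevel
      measurableSet_agreementLevel, ← hs'.tsum_eq,
      ENNReal.ofReal_tsum_of_nonneg levelArea_nonneg hs'.summable]
    exact tsum_congr fun n => (hasTriangulation_agreementLevel n).choose_spec.2.2
  obtain ⟨-, -, -, hT⟩ := hasTriangulation_T
  rw [measureReal_def, uniformT, ProbabilityTheory.cond_apply measurableSet_T, hv, hT,
    ENNReal.toReal_mul, ENNReal.toReal_inv, ENNReal.toReal_ofReal h0,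
    ENNReal.toReal_ofReal (by norm_num)]
  ring

/-! ### Summation of the areas in closed form -/

theorem hasSum_sub_of_antitone {f : ℕ → ℝ} (hf : Antitone f) (h0 : Tendsto f atTop (𝓝 0)) :
    HasSum (fun n => f n - f (n + 1)) (f 0) := by
  rw [hasSum_iff_tendsto_nat_of_nonneg fun n => sub_nonneg.mpr (hf n.le_succ)]
  simp only [sum_range_sub']
  simpa using h0.const_sub (f 0)

theorem hasSum_one_div_sub {a b : ℝ} (ha : 0 < a) (hb : 0 < b) :
    HasSum (fun j : ℕ => 1 / (a * j + b) - 1 / (a * (j + 1) + b)) (1 / b) := by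
  have h1 : Antitone fun j : ℕ => 1 / (a * j + b) := by
    intro i j hij
    have : (i : ℝ) ≤ j := by exact_mod_cast hij
    exact one_div_le_one_div_of_le (by positivity) (by gcongr)
  have h2 : Tendsto (fun j : ℕ => 1 / (a * j + b)) atTop (𝓝 0) := by
    simp only [one_div]
    exact (tendsto_atTop_add_const_right _ _
      (tendsto_natCast_atTop_atTop.const_mul_atTop ha)).inv_tendsto_atTop
  simpa using hasSum_sub_of_antitone h1 h2

theorem hasSum_one_div_odd_sq :
    HasSum (fun j : ℕ => 1 / (2 * (j : ℝ) + 1) ^ 2) (Real.pi ^ 2 / 8) := by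
  have hs : Summable fun j : ℕ => 1 / (2 * (j : ℝ) + 1) ^ 2 := by
    have := hasSum_zeta_two.summable.comp_injective (i := fun j : ℕ => 2 * j + 1)
      (fun a b h => by simpa using h)
    refine this.congr fun j => ?_
    simp
  have he : HasSum (fun j : ℕ => (1 : ℝ) / ((2 * j : ℕ) : ℝ) ^ 2) (1 / 4 * (Real.pi ^ 2 / 6)) := by
    refine (hasSum_zeta_two.mul_left (1 / 4)).congr_fun fun j => ?_
    push_cast
    rw [mul_pow, one_div_mul_one_div]
    norm_num
  have ho : HasSum (fun j : ℕ => (1 : ℝ) / ((2 * j + 1 : ℕ) : ℝ) ^ 2)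
      (∑' j : ℕ, 1 / (2 * (j : ℝ) + 1) ^ 2) := by
    simpa using hs.hasSum
  have := (HasSum.even_add_odd (f := fun n : ℕ => (1 : ℝ) / (n : ℝ) ^ 2) he ho).unique
    hasSum_zeta_two
  rw [show Real.pi ^ 2 / 8 = ∑' j : ℕ, 1 / (2 * (j : ℝ) + 1) ^ 2 by linarith]
  exact hs.hasSum

/-- The probability in closed form. -/
noncomputable def closedForm : ℂ :=
  (1 - Complex.I) * Complex.digamma (3 - Complex.I) +
    (1 + Complex.I) * Complex.digamma (3 + Complex.I) +
    (Real.pi : ℂ) ^ 2 / 4 + 2 * (Real.eulerMascheroniConstant : ℂ) - 115 / 27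

theorem add_natCast_ne_zero {z : ℂ} (hz : 0 < z.re) (j : ℕ) : z + j ≠ 0 := fun h => by
  have := congrArg Complex.re h
  simp at this
  linarith [(Nat.cast_nonneg j : (0 : ℝ) ≤ j)]

/-- Partial fractions with `n = j + 3`: the residues of `(2n+2)/(n²+1)` at `n = ±i` are `1 ∓ i`. The
share `2/n = (1-i)/n + (1+i)/n` is paired with these poles so that each series converges. -/
theorem four_mul_levelArea_add_three (j : ℕ) : ((4 * levelArea (j + 3) : ℝ) : ℂ) =
    (1 - Complex.I) * (1 / (3 + j) - 1 / (3 - Complex.I + j)) +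
      (1 + Complex.I) * (1 / (3 + j) - 1 / (3 + Complex.I + j)) +
      ((2 * (1 / (1 * j + 3) - 1 / (1 * (j + 1) + 3)) +
        2 * (1 / (2 * ((j + 2 : ℕ) : ℝ) + 1) ^ 2) -
        (1 / (2 * j + 5) - 1 / (2 * (j + 1) + 5)) : ℝ) : ℂ) := by
  have h1 : (3 : ℂ) - Complex.I + j ≠ 0 := add_natCast_ne_zero (by simp) j
  have h2 : (3 : ℂ) + Complex.I + j ≠ 0 := add_natCast_ne_zero (by simp) j
  have h3 : (3 : ℂ) + j ≠ 0 := add_natCast_ne_zero (by simp) j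
  have e1 : (1 - Complex.I) * (1 / (3 + j) - 1 / (3 - Complex.I + j)) +
      (1 + Complex.I) * (1 / (3 + j) - 1 / (3 + Complex.I + j)) =
      ((2 / (j + 3) - (2 * (j + 3) + 2) / ((j + 3) ^ 2 + 1) : ℝ) : ℂ) := by
    have h4 : ((j : ℂ) + 3) ^ 2 + 1 ≠ 0 := by
      have : ((j : ℂ) + 3) ^ 2 + 1 = (3 - Complex.I + j) * (3 + Complex.I + j) := by
        linear_combination Complex.I_sq
      rw [this]; exact mul_ne_zero h1 h2
    have h3' : (j : ℂ) + 3 ≠ 0 := by rwa [add_comm]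
    have e2 : (1 - Complex.I) / (3 - Complex.I + j) + (1 + Complex.I) / (3 + Complex.I + j) =
        (2 * (j + 3) + 2) / (((j : ℂ) + 3) ^ 2 + 1) := by
      rw [div_add_div _ _ h1 h2, div_eq_div_iff (mul_ne_zero h1 h2) h4]
      have : (3 - Complex.I + j) * (3 + Complex.I + j) = ((j : ℂ) + 3) ^ 2 + 1 := by
        linear_combination -Complex.I_sq
      rw [this]
      congr 1
      linear_combination (-2) * Complex.I_sq
    push_cast
    rw [← e2, add_comm (j : ℂ) 3]
    ring
  rw [e1, ← Complex.ofReal_add]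
  congr 1
  rw [levelArea, if_neg (by omega), if_neg (by omega), if_neg (by omega)]
  push_cast
  have h5 : 2 * ((j : ℝ) + 3) - 1 = 2 * j + 5 := by ring
  have h6 : 2 * ((j : ℝ) + 3) + 1 = 2 * j + 7 := by ring
  have h7 : 2 * ((j : ℝ) + 2) + 1 = 2 * j + 5 := by ring
  have h8 : 2 * ((j : ℝ) + 1) + 5 = 2 * j + 7 := by ring
  have h9 : (j : ℝ) + 3 + 1 = j + 4 := by ring
  have h10 : 1 * ((j : ℝ) + 1) + 3 = j + 4 := by ring
  rw [h5, h6, h7, h8, h9, h10, one_mul, mul_add]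
  have f1 : 4 * (1 / (((j : ℝ) + 3) * (j + 4) * ((j + 3) ^ 2 + 1))) =
      2 / (j + 3) - (2 * (j + 3) + 2) / ((j + 3) ^ 2 + 1) + 2 * (1 / (j + 3) - 1 / (j + 4)) := by
    field_simp; ring
  have f2 : 4 * (1 / ((2 * (j : ℝ) + 7) * (2 * j + 5) ^ 2)) =
      2 * (1 / (2 * j + 5) ^ 2) - (1 / (2 * j + 5) - 1 / (2 * j + 7)) := by
    field_simp; ring
  rw [f1, f2]; ring

theorem hasSum_levelArea_complex :
    HasSum (fun n => ((4 * levelArea n : ℝ) : ℂ)) closedForm := by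
  -- The levels 0, 1, 2 do not follow the general formula; they contribute `67/135` to the constant.
  rw [← hasSum_nat_add_iff' 3]
  have g1 := (hasSum_digamma_sub (z := 3 - Complex.I) (w := 3) (by simp) (by simp)).mul_left
    (1 - Complex.I)
  have g2 := (hasSum_digamma_sub (z := 3 + Complex.I) (w := 3) (by simp) (by simp)).mul_left
    (1 + Complex.I)
  have g3 := (hasSum_one_div_sub (a := 1) (b := 3) one_pos (by norm_num)).mul_left 2
  -- At `n = 3` the odd number `2n - 1` is 5, so the squares of 1 and 3 are dropped.
  have g4 := ((hasSum_nat_add_iff' 2).mpr hasSum_one_div_odd_sq).mul_left 2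
  have g5 := hasSum_one_div_sub (a := 2) (b := 5) two_pos (by norm_num)
  have g := (g1.add g2).add (Complex.hasSum_ofReal.mpr ((g3.add g4).sub g5))
  refine HasSum.congr_fun (?_ : HasSum _ _) four_mul_levelArea_add_three
  refine Eq.subst (motive := fun s => HasSum _ s) ?_ g
  rw [digamma_three]
  simp [sum_range_succ, levelArea, closedForm]
  ring

/-- A sum of real terms is real, so the complex closed form equals its real part. -/
theorem hasSum_levelArea : HasSum (fun n => 4 * levelArea n) closedForm.re ∧
    (closedForm.re : ℂ) = closedForm := by
  have h := hasSum_levelArea_complex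
  have h1 : HasSum (fun n => 4 * levelArea n) closedForm.re := by
    simpa only [Complex.ofReal_re] using Complex.hasSum_re h
  exact ⟨h1, (Complex.hasSum_ofReal.mpr h1).unique h⟩

/-! ### Numerical value -/

theorem four_mul_levelArea_le (j : ℕ) : 4 * levelArea (j + 16) ≤
    1 / 16 * (1 / (1 * j + 16) - 1 / (1 * (j + 1) + 16)) := by
  rw [levelArea, if_neg (by omega), if_neg (by omega), if_neg (by omega)]
  push_cast
  have hn : (16 : ℝ) ≤ j + 16 := by linarith [(Nat.cast_nonneg j : (0 : ℝ) ≤ j)]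
  rw [one_mul, one_mul, show (j : ℝ) + 1 + 16 = j + 16 + 1 by ring]
  generalize (j : ℝ) + 16 = n at hn
  have hpos : 0 < 2 * n - 1 := by linarith
  -- The share `1/64` covers the linear triangle, since `n² + 1 ≥ 256`, and `3/64` the general one,
  -- since `2n - 1 ≥ 31`.
  have e : 1 / 16 * (1 / n - 1 / (n + 1)) = 1 / 64 * (1 / (n * (n + 1))) +
      3 / 64 * (1 / (n * (n + 1))) := by
    field_simp; ring
  rw [e, mul_add]
  apply add_le_add
  · rw [← one_div_mul_one_div, mul_comm, mul_assoc, mul_comm]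
    refine mul_le_mul_of_nonneg_right ?_ (by positivity)
    rw [div_mul_eq_mul_div, div_le_iff₀ (by positivity)]
    nlinarith
  · rw [mul_one_div, mul_one_div, div_le_div_iff₀ (by positivity) (by positivity)]
    have : 31 * (2 * n - 1) ≤ (2 * n - 1) ^ 2 := by nlinarith
    have := mul_le_mul_of_nonneg_left this (show 0 ≤ 2 * n + 1 by linarith)
    nlinarith

theorem abs_closedForm_re_sub_lt : |closedForm.re - 0.60| < 0.005 := by
  have h := hasSum_levelArea.1
  have hl := sum_le_hasSum (range 16) (fun n _ => mul_nonneg (by norm_num) (levelArea_nonneg n)) h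
  have h16 : HasSum (fun j => 4 * levelArea (j + 16))
      (closedForm.re - ∑ n ∈ range 16, 4 * levelArea n) :=
    (hasSum_nat_add_iff' (f := fun n => 4 * levelArea n) 16).mpr h
  have hb : HasSum (fun j : ℕ => 1 / 16 * (1 / (1 * (j : ℝ) + 16) - 1 / (1 * (j + 1) + 16)))
      (1 / 16 * (1 / 16)) :=
    -- The tail is at most `1/256 < 0.004`, and the partial sum lies between 0.596 and 0.6.
    (hasSum_one_div_sub (a := 1) (b := 16) one_pos (by norm_num)).mul_left (1 / 16)
  have hu := hasSum_le four_mul_levelArea_le h16 hb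
  have h1 : 0.596 < ∑ n ∈ range 16, 4 * levelArea n := by
    norm_num [sum_range_succ, levelArea]
  have h2 : ∑ n ∈ range 16, 4 * levelArea n < 0.6 := by
    norm_num [sum_range_succ, levelArea]
  rw [abs_lt]
  constructor <;> linarith

end WeakCoin

end

theorem mainTheorem12 :
    ((WeakCoin.uniformT.real WeakCoin.agreement : ℝ) : ℂ) =
        (1 - Complex.I) * Complex.digamma (3 - Complex.I) +
          (1 + Complex.I) * Complex.digamma (3 + Complex.I) +
          (Real.pi : ℂ) ^ 2 / 4 + 2 * (Real.eulerMascheroniConstant : ℂ) - 115 / 27 ∧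
      |WeakCoin.uniformT.real WeakCoin.agreement - 0.60| < 0.005 ∧
      ∃ F : ℕ → Finset (Affine.Triangle ℝ (ℝ × ℝ)),
        (∀ n : ℕ, WeakCoin.agreementLevel n =ᵐ[MeasureTheory.volume]
          ⋃ t ∈ F n, t.closedInterior) ∧
        HasSum
          (fun n : ℕ => ∑ t ∈ F n, MeasureTheory.volume.real t.closedInterior /
            MeasureTheory.volume.real WeakCoin.T)
          (WeakCoin.uniformT.real WeakCoin.agreement) := by
  have hP := WeakCoin.uniformT_real_agreement WeakCoin.hasSum_levelArea.1
  have hT : MeasureTheory.volume.real WeakCoin.T = 1 / 4 := by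
    obtain ⟨-, -, -, h⟩ := WeakCoin.hasTriangulation_T
    rw [MeasureTheory.measureReal_def, h, ENNReal.toReal_ofReal (by norm_num)]
  rw [hP, hT]
  refine ⟨WeakCoin.hasSum_levelArea.2, WeakCoin.abs_closedForm_re_sub_lt, ?_⟩
  choose F hF hA _ using WeakCoin.hasTriangulation_agreementLevel
  refine ⟨F, hF, ?_⟩
  convert WeakCoin.hasSum_levelArea.1 using 2 with n
  rw [← Finset.sum_div, hA]
  ring
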